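/- All Lie algebras are over $\mathbb C$ and finite-dimensional unless said otherwise, and $p\ge 1$. For $\omega\in\mathfrak g^*$ let $d\omega(x,y)=-\omega([x,y])$. A $2p$-dimensional Lie algebra $\mathfrak g$ is \emph{frobeniusian} if there is $\omega\in\mathfrak g^*$, $\omega\neq 0$, with $(d\omega)^p=d\omega\wedge\dots\wedge d\omega\neq 0$ (the same definition is used over $\mathbb C[[t]]$). A Lie algebra $\mathfrak g_0$ with bracket $\mu_0$ \emph{contracts onto} a Lie algebra $\mathfrak g$ with bracket $\mu$ if there are linear isomorphisms $f_t:\mathfrak g\to\mathfrak g_0$ ($t>0$) such that $f_t^{-1}\circ\mu_0\circ(f_t\times f_t)\to\mu$ as $t\to 0^+$, in the finite-dimensional space of bilinear maps $\mathfrak g\times\mathfrak g\to\mathfrak g$. For $a=(a_1,\dots,a_{p-1})\in\mathbb C^{p-1}$ let $\mathfrak g_a$ be the $2p$-dimensional Lie algebra with Maurer--Cartan equations $$d\omega_1=\omega_1\wedge\omega_2+\sum_{k=1}^{p-1}\omega_{2k+1}\wedge\omega_{2k+2},\qquad d\omega_2=0,$$ $$d\omega_{2k+1}=a_k\,\omega_2\wedge\omega_{2k+1},\qquad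 d\omega_{2k+2}=-(1+a_k)\,\omega_2\wedge\omega_{2k+2}\qquad(1\le k\le p-1).$$ \textbf{Theorem.} The family $\{\mathfrak g_a\}_{a\in\mathbb C^{p-1}}$ is a model for the property of being frobeniusian, that is: (0) every $\mathfrak g_a$ is a $2p$-dimensional frobeniusian Lie algebra; (1) every $2p$-dimensional frobeniusian Lie algebra contracts onto $\mathfrak g_a$ for some $a\in\mathbb C^{p-1}$; (2) no $\mathfrak g_a$ contracts onto a different (that is, non-isomorphic) member of the family: if $\mathfrak g_a$ contracts onto $\mathfrak g_{a'}$, then $\mathfrak g_a\cong\mathfrak g_{a'}$; (3) every deformation of a $\mathfrak g_a$ is frobeniusian, both in the formal sense (every Lie algebra over $\mathbb C[[t]]$ with underlying module $\mathfrak g_a[[t]]$ and bracket $\mu+t\varphi_1+t^2\varphi_2+\cdots$, where $\mu$ is the bracket of $\mathfrak g_a$, is frobeniusian over $\mathbb C[[t]]$) and in the variety of Lie algebra laws on $\mathbb C^{2p}$ (the law of $\mathfrak g_a$, in any basis, has a Zariski-open neighbourhood all of whose members are frobeniusian). -/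

import Mathlib

open Filter Topology

universe u

/-- The exterior differential of a linear form `ω` on a Lie algebra (Chevalley–Eilenberg, trivial
coefficients): the `2`-form `dω(x, y) = -ω([x, y])`. -/
def lieD {K : Type*} [CommRing K] {L : Type*} [LieRing L] [LieAlgebra K L]
    (ω : Module.Dual K L) (x y : L) : K :=
  -ω ⁅x, y⁆

/-- The `p`-fold exterior power `θ ∧ ⋯ ∧ θ` of a `2`-form `θ`, evaluated at the `2p` vectors
`x (0,0), x (0,1), x (1,0), x (1,1), …`:
`θ^p (x) = 2⁻ᵖ ∑_σ sign(σ) ∏_k θ (x (σ (k,0)), x (σ (k,1)))`. -/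
noncomputable def wedgePow {K : Type*} [CommRing K] [Algebra ℚ K] {L : Type*}
    (θ : L → L → K) (p : ℕ) (x : Fin p × Fin 2 → L) : K :=
  algebraMap ℚ K (1 / 2 ^ p) *
    ∑ σ : Equiv.Perm (Fin p × Fin 2),
      ((Equiv.Perm.sign σ : ℤ) : K) * ∏ k : Fin p, θ (x (σ (k, 0))) (x (σ (k, 1)))

/-- A `2p`-dimensional Lie algebra is frobeniusian if it carries a linear form `ω ≠ 0` with
`(dω)^p ≠ 0`. (The base ring is `ℂ`, or `ℂ⟦X⟧` for formal deformations.) -/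
def IsFrobeniusian (K : Type*) [CommRing K] [Algebra ℚ K] (L : Type*) [LieRing L]
    [LieAlgebra K L] (p : ℕ) : Prop :=
  Module.Finite K L ∧ Module.finrank K L = 2 * p ∧
    ∃ ω : Module.Dual K L, ω ≠ 0 ∧ ∃ x : Fin p × Fin 2 → L, wedgePow (lieD ω) p x ≠ 0

/-- `L` contracts onto `L'` (finite-dimensional complex Lie algebras): there are linear
isomorphisms `f t : L' → L`, `t > 0`, such that the brackets `(f t)⁻¹ [f t x, f t y]`, each of
which is isomorphic to that of `L`, converge to the bracket of `L'` as `t → 0⁺`. Convergence in the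
finite-dimensional space of bilinear maps is convergence of all coordinates, that is, after
evaluation at all pairs of vectors and application of all linear forms. -/
def ContractsOnto (L L' : Type*) [LieRing L] [LieAlgebra ℂ L] [LieRing L'] [LieAlgebra ℂ L'] :
    Prop :=
  ∃ f : ℝ → (L' ≃ₗ[ℂ] L), ∀ (x y : L') (φ : Module.Dual ℂ L'),
    Tendsto (fun t => φ ((f t).symm ⁅f t x, f t y⁆)) (𝓝[>] 0) (𝓝 (φ ⁅x, y⁆))

/-- Structure constants of a Lie algebra in a basis: `[b i, b j] = ∑ k, C (i, j, k) • b k`. -/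
noncomputable def structureConstants {K : Type*} [CommRing K] {L : Type*} [LieRing L]
    [LieAlgebra K L] {n : ℕ} (b : Module.Basis (Fin n) K L) : Fin n × Fin n × Fin n → K :=
  fun c => b.repr ⁅b c.1, b c.2.1⁆ c.2.2

/-- The Lie algebra `G` over `ℂ⟦X⟧` is a formal deformation of the complex Lie algebra `L`:
`G = L⟦X⟧` as a module, and its bracket is `μ₀ + X φ₁ + X² φ₂ + ⋯` with `μ₀` the bracket of `L`;
in other words, the structure constants of `G` in a suitable basis are power series whose constant
terms are the structure constants of `L`. -/
def IsFormalDeformation (L G : Type*) [LieRing L] [LieAlgebra ℂ L] [LieRing G]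
    [LieAlgebra (PowerSeries ℂ) G] : Prop :=
  ∃ (n : ℕ) (b : Module.Basis (Fin n) ℂ L) (B : Module.Basis (Fin n) (PowerSeries ℂ) G),
    ∀ c, PowerSeries.constantCoeff (structureConstants B c) = structureConstants b c

/-- Indices of a basis of a `2(m+1)`-dimensional space: `inl 0, inl 1` stand for `1, 2`, and
`inr (k, 0), inr (k, 1)` for `2k+1, 2k+2` where the pairs are numbered by `k : Fin m`. -/
abbrev AdaptedIndex (m : ℕ) : Type := Fin 2 ⊕ (Fin m × Fin 2)

/-- The `2`-form `ω_i ∧ ω_j` on `ℂ^ι`, where the `ω_i` are the coordinate forms. -/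
def coordWedge {ι : Type*} (i j : ι) (x y : ι → ℂ) : ℂ := x i * y j - x j * y i

/-- The right-hand sides of the Maurer–Cartan equations of the Lie algebra with parameters `a`. -/
def maurerCartanForm {m : ℕ} (a : Fin m → ℂ) : AdaptedIndex m →
    (AdaptedIndex m → ℂ) → (AdaptedIndex m → ℂ) → ℂ
  | .inl 0, x, y => coordWedge (.inl 0) (.inl 1) x y +
      ∑ k : Fin m, coordWedge (.inr (k, 0)) (.inr (k, 1)) x y
  | .inl 1, _, _ => 0
  | .inr (k, 0), x, y => a k * coordWedge (.inl 1) (.inr (k, 0)) x y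
  | .inr (k, 1), x, y => -(1 + a k) * coordWedge (.inl 1) (.inr (k, 1)) x y

/-- The underlying space `ℂ^(2(m+1))` of the Lie algebra with parameters `a`. -/
def FrobModel {m : ℕ} (_a : Fin m → ℂ) : Type := AdaptedIndex m → ℂ

instance {m : ℕ} (a : Fin m → ℂ) : AddCommGroup (FrobModel a) :=
  inferInstanceAs (AddCommGroup (AdaptedIndex m → ℂ))

instance {m : ℕ} (a : Fin m → ℂ) : Module ℂ (FrobModel a) :=
  inferInstanceAs (Module ℂ (AdaptedIndex m → ℂ))

/-- The bracket prescribed by the Maurer–Cartan equations: `ω_i([x, y]) = -dω_i(x, y)`. -/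
instance {m : ℕ} (a : Fin m → ℂ) : Bracket (FrobModel a) (FrobModel a) where
  bracket x y := fun i => -maurerCartanForm a i x y

theorem FrobModel.lie_apply {m : ℕ} (a : Fin m → ℂ) (x y : FrobModel a) (i : AdaptedIndex m) :
    (⁅x, y⁆ : FrobModel a) i = -maurerCartanForm a i x y := rfl

theorem FrobModel.add_apply {m : ℕ} (a : Fin m → ℂ) (x y : FrobModel a) (i : AdaptedIndex m) :
    (x + y) i = x i + y i := rfl

theorem FrobModel.smul_apply {m : ℕ} (a : Fin m → ℂ) (c : ℂ) (x : FrobModel a)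
    (i : AdaptedIndex m) : (c • x) i = c * x i := rfl

theorem FrobModel.zero_apply {m : ℕ} (a : Fin m → ℂ) (i : AdaptedIndex m) :
    (0 : FrobModel a) i = 0 := rfl

instance {m : ℕ} (a : Fin m → ℂ) : LieRing (FrobModel a) where
  add_lie x y z := by
    funext i
    rcases i with i | ⟨k, i⟩ <;> fin_cases i <;>
      simp [FrobModel.lie_apply, FrobModel.add_apply, maurerCartanForm, coordWedge,
        add_mul, Finset.sum_add_distrib, Finset.sum_sub_distrib] <;> ring
  lie_add x y z := by
    funext i
    rcases i with i | ⟨k, i⟩ <;> fin_cases i <;>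
      simp [FrobModel.lie_apply, FrobModel.add_apply, maurerCartanForm, coordWedge,
        add_mul, mul_add, Finset.sum_add_distrib, Finset.sum_sub_distrib] <;> ring
  lie_self x := by
    funext i
    rcases i with i | ⟨k, i⟩ <;> fin_cases i <;>
      simp [FrobModel.lie_apply, FrobModel.zero_apply, maurerCartanForm, coordWedge, mul_comm]
  leibniz_lie x y z := by
    funext i
    rcases i with i | ⟨k, i⟩ <;> fin_cases i
    · have key : ∀ u v w : FrobModel a,
          maurerCartanForm a (.inl 0) u (⁅v, w⁆ : FrobModel a) =
            u (.inl 1) * (v (.inl 0) * w (.inl 1) - v (.inl 1) * w (.inl 0)) +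
            ∑ k : Fin m, (u (.inl 1) * (v (.inr (k, 0)) * w (.inr (k, 1))
                - v (.inr (k, 1)) * w (.inr (k, 0)))
              + (u (.inr (k, 0)) * ((1 + a k) * (v (.inl 1) * w (.inr (k, 1))
                  - v (.inr (k, 1)) * w (.inl 1)))
                + u (.inr (k, 1)) * (a k * (v (.inl 1) * w (.inr (k, 0))
                  - v (.inr (k, 0)) * w (.inl 1))))) := by
        intro u v w
        rw [Finset.sum_add_distrib, ← Finset.mul_sum]
        simp only [maurerCartanForm, coordWedge, FrobModel.lie_apply]
        rw [show (∑ k : Fin m, (u (.inr (k, 0)) * -(-(1 + a k) * (v (.inl 1) * w (.inr (k, 1))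
                  - v (.inr (k, 1)) * w (.inl 1)))
                - u (.inr (k, 1)) * -(a k * (v (.inl 1) * w (.inr (k, 0))
                  - v (.inr (k, 0)) * w (.inl 1))))) =
              ∑ k : Fin m, (u (.inr (k, 0)) * ((1 + a k) * (v (.inl 1) * w (.inr (k, 1))
                  - v (.inr (k, 1)) * w (.inl 1)))
                + u (.inr (k, 1)) * (a k * (v (.inl 1) * w (.inr (k, 0))
                  - v (.inr (k, 0)) * w (.inl 1)))) from
            Finset.sum_congr rfl fun k _ => by ring]
        ring
      have skew : ∀ u v : FrobModel a,
          maurerCartanForm a (.inl 0) u v = -maurerCartanForm a (.inl 0) v u := by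
        intro u v
        simp only [maurerCartanForm, coordWedge, neg_add, ← Finset.sum_neg_distrib]
        congr 1
        · ring
        · exact Finset.sum_congr rfl fun k _ => by ring
      simp only [FrobModel.lie_apply, FrobModel.add_apply, Fin.zero_eta]
      rw [skew ⁅x, y⁆ z, key, key, key]
      have h : ∀ A B C S T U : ℂ, A = B - C → S = T - U →
          -(A + S) = - -(C + U) + -(B + T) := by
        intro A B C S T U h₁ h₂
        rw [h₁, h₂]
        ring
      apply h
      · ring
      · rw [← Finset.sum_sub_distrib]
        exact Finset.sum_congr rfl fun k _ => by ring
    all_goals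
      simp only [FrobModel.lie_apply, FrobModel.add_apply, maurerCartanForm, coordWedge,
        Fin.zero_eta, Fin.mk_one]
      ring

instance {m : ℕ} (a : Fin m → ℂ) : LieAlgebra ℂ (FrobModel a) where
  lie_smul c x y := by
    funext i
    rcases i with i | ⟨k, i⟩ <;> fin_cases i <;>
      simp [FrobModel.lie_apply, FrobModel.smul_apply, maurerCartanForm, coordWedge,
        mul_add, mul_sub, Finset.mul_sum, Finset.sum_sub_distrib, mul_left_comm]

/-- The `i`-th coordinate form `ω_i`. -/
def FrobModel.coord {m : ℕ} (a : Fin m → ℂ) (i : AdaptedIndex m) :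
    Module.Dual ℂ (FrobModel a) :=
  LinearMap.proj (R := ℂ) (φ := fun _ : AdaptedIndex m => ℂ) i

/-- The Maurer–Cartan equations hold in `FrobModel a`. -/
theorem FrobModel.lieD_coord {m : ℕ} (a : Fin m → ℂ) (i : AdaptedIndex m) (x y : FrobModel a) :
    lieD (FrobModel.coord a i) x y = maurerCartanForm a i x y :=
  neg_neg (maurerCartanForm a i x y)

/-! For a frobeniusian algebra with form `ω`, the 2-form `θ = dω` is symplectic, so there is a
vector `v` with `ω ∘ ad v = ω`. By the Jacobi identity, `M(x, y) = θ([v, x], y)` satisfies `M(x, y)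
- M(y, x) = θ(x, y)`. This lets a symplectic basis be chosen in which `ad v` is triangular
(`exists_symplectic_triangular`, `IsFrobeniusian.exists_triangular_basis`), its eigenvalues off the
plane of `v` and a vector `u` with `ω u = 1` coming in pairs `-a k`, `1 + a k`. Rescaling the basis
vectors by suitable powers of `t` removes everything but the diagonal of `ad v` and the symplectic
pairing, which leaves a model (`contractsOnto_of_weights`, `IsFrobeniusian.exists_contractsOnto`).

Models are separated by the characteristic polynomial of `ad`, which is continuous along
contractions. In a model both the trace and the spectrum of `ad x` depend on the `ω₂`-coordinate of
`x` alone, and the trace recovers that coordinate without reference to `a`. Hence a contraction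
preserves the multiset of the numbers `a k * (1 + a k)`, and this multiset determines the model up
to isomorphism (`FrobModel.nonempty_lieEquiv`).

Stability under deformation holds because `(dω)^p`, evaluated on a basis for fixed coordinates of
`ω`, is a polynomial in the structure constants: it is nonzero near a point where it is nonzero, and
nonzero over power series if its constant term is. -/

/-! ### Exterior powers of 2-forms and nondegeneracy. -/

/-- Serves both notions of deformation: the ring homomorphism is either the constant coefficient of
power series or the evaluation of polynomials at structure constants. -/
theorem map_wedgePow {K K' : Type*} [CommRing K] [Algebra ℚ K] [CommRing K'] [Algebra ℚ K']
    {L L' : Type*} (φ : K →+* K') {θ : L → L → K} {θ' : L' → L' → K'} {p : ℕ}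
    {x : Fin p × Fin 2 → L} {x' : Fin p × Fin 2 → L'}
    (h : ∀ i j, φ (θ (x i) (x j)) = θ' (x' i) (x' j)) :
    φ (wedgePow θ p x) = wedgePow θ' p x' := by
  simp [wedgePow, map_mul, map_sum, map_prod, h, φ.map_rat_algebraMap]

/-- The `2`-form `dω` as a bilinear map. -/
def lieDForm {K : Type*} [CommRing K] {L : Type*} [LieRing L] [LieAlgebra K L]
    (ω : Module.Dual K L) : L →ₗ[K] L →ₗ[K] K :=
  LinearMap.mk₂ K (lieD ω)
    (fun x y z => by simp only [lieD, add_lie, map_add]; ring)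
    (fun c x y => by simp [lieD])
    (fun x y z => by simp only [lieD, lie_add, map_add]; ring)
    (fun c x y => by simp [lieD])

theorem lieDForm_apply {K : Type*} [CommRing K] {L : Type*} [LieRing L] [LieAlgebra K L]
    (ω : Module.Dual K L) (x y : L) : lieDForm ω x y = -ω ⁅x, y⁆ := rfl

theorem lieDForm_self {K : Type*} [CommRing K] {L : Type*} [LieRing L] [LieAlgebra K L]
    (ω : Module.Dual K L) (x : L) : lieDForm ω x x = 0 := by simp [lieDForm_apply]

section
variable {K : Type*} [CommRing K] {L : Type*} [AddCommGroup L] [Module K L]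

/-- The multilinear map `x ↦ ∏ k, θ (x (k, 0), x (k, 1))`. -/
def pairingProd (θ : L →ₗ[K] L →ₗ[K] K) (p : ℕ) :
    MultilinearMap K (fun _ : Fin p × Fin 2 => L) K where
  toFun x := ∏ k, θ (x (k, 0)) (x (k, 1))
  map_update_add' := by
    rintro _ x ⟨k, i⟩ u v
    have h : ∀ w : L, ∀ l ∈ Finset.univ.erase k, θ (Function.update x (k, i) w (l, 0))
        (Function.update x (k, i) w (l, 1)) = θ (x (l, 0)) (x (l, 1)) := by
      intro w l hl
      have hl : l ≠ k := Finset.ne_of_mem_erase hl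
      rw [Function.update_of_ne (by simp [hl]), Function.update_of_ne (by simp [hl])]
    simp only [← Finset.mul_prod_erase Finset.univ _ (Finset.mem_univ k)]
    rw [Finset.prod_congr rfl (h _), Finset.prod_congr rfl (h _), Finset.prod_congr rfl (h _)]
    fin_cases i <;> simp [add_mul]
  map_update_smul' := by
    rintro _ x ⟨k, i⟩ c u
    have h : ∀ w : L, ∀ l ∈ Finset.univ.erase k, θ (Function.update x (k, i) w (l, 0))
        (Function.update x (k, i) w (l, 1)) = θ (x (l, 0)) (x (l, 1)) := by
      intro w l hl
      have hl : l ≠ k := Finset.ne_of_mem_erase hl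
      rw [Function.update_of_ne (by simp [hl]), Function.update_of_ne (by simp [hl])]
    simp only [← Finset.mul_prod_erase Finset.univ _ (Finset.mem_univ k)]
    rw [Finset.prod_congr rfl (h _), Finset.prod_congr rfl (h _)]
    fin_cases i <;> simp [mul_assoc]

/-- The `p`-th exterior power of a bilinear form, as an alternating map. -/
noncomputable def wedgePowMap [Algebra ℚ K] (θ : L →ₗ[K] L →ₗ[K] K) (p : ℕ) :
    L [⋀^Fin p × Fin 2]→ₗ[K] K :=
  algebraMap ℚ K (1 / 2 ^ p) • MultilinearMap.alternatization (pairingProd θ p)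

theorem wedgePowMap_apply [Algebra ℚ K] (θ : L →ₗ[K] L →ₗ[K] K) (p : ℕ)
    (x : Fin p × Fin 2 → L) : wedgePowMap θ p x = wedgePow (fun u v => θ u v) p x := by
  simp only [wedgePowMap, AlternatingMap.smul_apply, MultilinearMap.alternatization_apply,
    smul_eq_mul, wedgePow]
  simp [pairingProd, Units.smul_def]

end

/-- The vectors `x` form a basis, since an alternating map vanishes on dependent families. Putting
`v` in place of `x i` multiplies the power by the `i`-th coordinate of `v`, yet gives zero because
every product then has a factor containing `v`. So all coordinates of `v` vanish. -/
theorem eq_zero_of_wedgePow_ne_zero {L : Type*} [AddCommGroup L] [Module ℂ L]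
    {θ : L →ₗ[ℂ] L →ₗ[ℂ] ℂ} {p : ℕ} (hp : 1 ≤ p) (hL : Module.finrank ℂ L = 2 * p)
    {x : Fin p × Fin 2 → L} (hx : wedgePow (fun u v => θ u v) p x ≠ 0)
    (hθ : ∀ u, θ u u = 0) {v : L} (hv : ∀ u, θ v u = 0) : v = 0 := by
  have hv' : ∀ u, θ u v = 0 := by
    intro u
    have := hθ (u + v)
    simpa [hθ, hv] using this
  rw [← wedgePowMap_apply] at hx
  have hli : LinearIndependent ℂ x := by
    by_contra h
    exact hx ((wedgePowMap θ p).map_linearDependent x h)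
  have : Nonempty (Fin p × Fin 2) := ⟨(⟨0, hp⟩, 0)⟩
  let b := basisOfLinearIndependentOfCardEqFinrank hli (by simp [hL, mul_comm])
  have hb : ∀ i, b i = x i := fun i => by simp [b]
  rw [← b.sum_repr v]
  refine Finset.sum_eq_zero fun i _ => ?_
  have h0 : wedgePowMap θ p (Function.update x i v) = 0 := by
    rw [wedgePowMap_apply, wedgePow]
    convert mul_zero _
    refine Finset.sum_eq_zero fun σ _ => ?_
    convert mul_zero _
    obtain ⟨⟨k, j⟩, hk⟩ := σ.surjective i
    refine Finset.prod_eq_zero (Finset.mem_univ k) ?_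
    fin_cases j
    · simp only [Fin.zero_eta] at hk
      simp [hk, hv]
    · simp only [Fin.mk_one] at hk
      simp [hk, hv']
  have h1 : wedgePowMap θ p (Function.update x i v) = b.repr v i * wedgePowMap θ p x := by
    conv_lhs => rw [← b.sum_repr v]
    rw [AlternatingMap.map_update_sum, Finset.sum_eq_single i]
    · simp [hb, AlternatingMap.map_update_smul]
    · intro j _ hj
      rw [AlternatingMap.map_update_smul, hb, AlternatingMap.map_update_self _ _ hj.symm,
        smul_zero]
    · simp
  rw [h1, mul_eq_zero, or_iff_left hx] at h0
  simp [h0]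

/-- The standard symplectic Gram matrix on `ι × Fin 2`. -/
def symplecticGram {ι : Type*} [DecidableEq ι] (i j : ι × Fin 2) : ℂ :=
  if i.1 = j.1 then (if i.2 = j.2 then 0 else if i.2 = 0 then 1 else -1) else 0

/-- No cancellation occurs in the sum. A permutation with a nonzero term carries pairs to pairs, so
it is a permutation `π` of the pairs followed or preceded by flips `τ k` inside them; `π` acts on
both members of each pair and contributes sign `1`, while the signs of the flips cancel those of the
Gram entries. Such a term is `1`, and the identity is one of them. -/
theorem wedgePow_ne_zero_of_symplectic {L : Type*} {θ : L → L → ℂ} {p : ℕ}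
    {x : Fin p × Fin 2 → L} (hx : ∀ i j, θ (x i) (x j) = symplecticGram i j) :
    wedgePow θ p x ≠ 0 := by
  have key : ∀ σ : Equiv.Perm (Fin p × Fin 2), ∃ r : ℝ, 0 ≤ r ∧
      ((Equiv.Perm.sign σ : ℤ) : ℂ) * ∏ k, θ (x (σ (k, 0))) (x (σ (k, 1))) = r := by
    intro σ
    by_cases h : ∃ k, (σ (k, 0)).1 ≠ (σ (k, 1)).1
    · obtain ⟨k, hk⟩ := h
      refine ⟨0, le_rfl, ?_⟩
      rw [Finset.prod_eq_zero (Finset.mem_univ k) (by rw [hx, symplecticGram, if_neg hk])]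
      simp
    push Not at h
    have hinj : Function.Injective fun k => (σ (k, 0)).1 := by
      intro k l hkl
      have h0 : (σ (k, 0)).2 ≠ (σ (k, 1)).2 := fun e => by
        simpa using σ.injective (Prod.ext (h k) e)
      have hkl : (σ (k, 0)).1 = (σ (l, 0)).1 := hkl
      have : (σ (l, 0)).2 = (σ (k, 0)).2 ∨ (σ (l, 0)).2 = (σ (k, 1)).2 := by omega
      rcases this with e | e
      · exact congrArg Prod.fst (σ.injective (Prod.ext hkl e.symm))
      · exact (congrArg Prod.fst (σ.injective (Prod.ext (hkl.symm.trans (h k)) e))).symm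
    let π : Equiv.Perm (Fin p) := Equiv.ofBijective _ (Finite.injective_iff_bijective.1 hinj)
    let τ : Fin p → Equiv.Perm (Fin 2) := fun k => if (σ (k, 0)).2 = 0 then 1 else Equiv.swap 0 1
    have hσ : σ = (Equiv.prodCongrLeft fun _ : Fin 2 => π) * Equiv.prodCongrRight τ := by
      ext1 ⟨k, i⟩
      have h0 : (σ (k, 0)).2 ≠ (σ (k, 1)).2 := fun e => by
        simpa using σ.injective (Prod.ext (h k) e)
      refine Prod.ext ?_ ?_
      · fin_cases i <;> simp [π, h]
      · by_cases h2 : (σ (k, 0)).2 = 0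
        · fin_cases i <;> simp [τ, h2]
          omega
        · fin_cases i <;> simp [τ, h2] <;> omega
    have hs : Equiv.Perm.sign σ = ∏ k, Equiv.Perm.sign (τ k) := by
      rw [hσ, map_mul, Equiv.Perm.sign_prodCongrLeft, Equiv.Perm.sign_prodCongrRight]
      simp
    refine ⟨1, zero_le_one, ?_⟩
    rw [hs, Units.coe_prod, Int.cast_prod, ← Finset.prod_mul_distrib]
    rw [Finset.prod_eq_one, Complex.ofReal_one]
    intro k _
    have h0 : (σ (k, 0)).2 ≠ (σ (k, 1)).2 := fun e => by
      simpa using σ.injective (Prod.ext (h k) e)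
    rw [hx, symplecticGram, if_pos (h k), if_neg h0]
    by_cases h2 : (σ (k, 0)).2 = 0 <;> simp [τ, h2]
  choose r hr hr' using key
  rw [wedgePow, Finset.sum_congr rfl fun σ _ => hr' σ, ← Complex.ofReal_sum]
  refine mul_ne_zero (by simp) ?_
  rw [Complex.ofReal_ne_zero]
  have h1 : r 1 = 1 := by
    have := hr' 1
    simp [hx, symplecticGram] at this
    exact_mod_cast this.symm
  have := Finset.single_le_sum (f := r) (fun σ _ => hr σ) (Finset.mem_univ 1)
  rw [h1] at this
  exact (lt_of_lt_of_le one_pos this).ne'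

/-- An alternating map that is zero on a basis indexed by its arguments is zero. The condition can
therefore be tested on one basis, where it concerns structure constants only. -/
theorem wedgePow_lieD_basis_ne_zero {K : Type*} [CommRing K] [Algebra ℚ K] {L : Type*} [LieRing L]
    [LieAlgebra K L] {ω : Module.Dual K L} {p : ℕ} {x : Fin p × Fin 2 → L}
    (hx : wedgePow (lieD ω) p x ≠ 0) (b : Module.Basis (Fin p × Fin 2) K L) :
    wedgePow (lieD ω) p b ≠ 0 := by
  have h : ∀ y, wedgePowMap (lieDForm ω) p y = wedgePow (lieD ω) p y :=
    wedgePowMap_apply (lieDForm ω) p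
  rw [← h] at hx ⊢
  rw [AlternatingMap.map_basis_ne_zero_iff]
  rintro h0
  simp [h0] at hx

theorem ne_zero_of_wedgePow_lieD_ne_zero {K : Type*} [CommRing K] [Algebra ℚ K] {L : Type*}
    [LieRing L] [LieAlgebra K L] {ω : Module.Dual K L} {p : ℕ} (hp : 1 ≤ p)
    {x : Fin p × Fin 2 → L} (hx : wedgePow (lieD ω) p x ≠ 0) : ω ≠ 0 := by
  rintro rfl
  apply hx
  have : p ≠ 0 := by omega
  simp [wedgePow, lieD, this]

/-! ### The models are frobeniusian, with `ω₁` as the form. -/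

/-- The basis of `FrobModel a` dual to the forms `ω_i`. -/
noncomputable def FrobModel.stdBasis {m : ℕ} (a : Fin m → ℂ) :
    Module.Basis (AdaptedIndex m) ℂ (FrobModel a) :=
  Pi.basisFun ℂ (AdaptedIndex m)

theorem FrobModel.stdBasis_apply {m : ℕ} (a : Fin m → ℂ) (i j : AdaptedIndex m) :
    FrobModel.stdBasis a i j = if j = i then 1 else 0 := by
  have : FrobModel.stdBasis a i = (Pi.single i 1 : AdaptedIndex m → ℂ) :=
    Pi.basisFun_apply ℂ (AdaptedIndex m) i
  rw [this, Pi.single_apply]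

theorem FrobModel.stdBasis_repr {m : ℕ} (a : Fin m → ℂ) (x : FrobModel a) (i : AdaptedIndex m) :
    (FrobModel.stdBasis a).repr x i = x i :=
  Pi.basisFun_repr (R := ℂ) (η := AdaptedIndex m) x i

theorem FrobModel.finrank_eq {m : ℕ} (a : Fin m → ℂ) :
    Module.finrank ℂ (FrobModel a) = 2 * (m + 1) := by
  rw [Module.finrank_eq_card_basis (FrobModel.stdBasis a)]
  simp
  ring

instance {m : ℕ} (a : Fin m → ℂ) : Module.Finite ℂ (FrobModel a) :=
  Module.Finite.of_basis (FrobModel.stdBasis a)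

/-- The pairs `(ω₁, ω₂), (ω₃, ω₄), …` as a family indexed by `Fin (m + 1) × Fin 2`. -/
def adaptedIndexOfPair {m : ℕ} (i : Fin (m + 1) × Fin 2) : AdaptedIndex m :=
  Fin.cases (.inl i.2) (fun k => .inr (k, i.2)) i.1

theorem FrobModel.exists_wedgePow_ne_zero {m : ℕ} (a : Fin m → ℂ) :
    ∃ (ω : Module.Dual ℂ (FrobModel a)) (x : Fin (m + 1) × Fin 2 → FrobModel a),
      wedgePow (lieD ω) (m + 1) x ≠ 0 := by
  refine ⟨FrobModel.coord a (.inl 0), fun i => FrobModel.stdBasis a (adaptedIndexOfPair i),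
    wedgePow_ne_zero_of_symplectic ?_⟩
  rintro ⟨k, i⟩ ⟨l, j⟩
  rw [FrobModel.lieD_coord]
  refine Fin.cases ?_ (fun k => ?_) k <;> refine Fin.cases ?_ (fun l => ?_) l
  · fin_cases i <;> fin_cases j <;> simp [adaptedIndexOfPair, maurerCartanForm, coordWedge,
      FrobModel.stdBasis_apply, symplecticGram]
  · simp [adaptedIndexOfPair, maurerCartanForm, coordWedge,
      FrobModel.stdBasis_apply, symplecticGram, (Fin.succ_ne_zero l).symm]
  · simp [adaptedIndexOfPair, maurerCartanForm, coordWedge,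
      FrobModel.stdBasis_apply, symplecticGram]
  · by_cases h : k = l
    · subst h
      fin_cases i <;> fin_cases j <;> simp [adaptedIndexOfPair, maurerCartanForm, coordWedge,
        FrobModel.stdBasis_apply, symplecticGram, Prod.ext_iff]
    · fin_cases i <;> fin_cases j <;> simp [adaptedIndexOfPair, maurerCartanForm, coordWedge,
        FrobModel.stdBasis_apply, symplecticGram, Prod.ext_iff, h, Ne.symm h,
        ← ite_and]

theorem FrobModel.isFrobeniusian {m : ℕ} (a : Fin m → ℂ) :
    IsFrobeniusian ℂ (FrobModel a) (m + 1) := by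
  obtain ⟨ω, x, hx⟩ := FrobModel.exists_wedgePow_ne_zero a
  exact ⟨inferInstance, FrobModel.finrank_eq a, ω,
    ne_zero_of_wedgePow_lieD_ne_zero (by omega) hx, x, hx⟩

/-! ### Stability under formal deformation and Zariski openness. -/

/-- The linear form with prescribed values on a basis takes on brackets of basis vectors the
values given by the structure constants. -/
theorem lieD_constr {K : Type*} [CommRing K] {L : Type*} [LieRing L] [LieAlgebra K L] {n : ℕ}
    (b : Module.Basis (Fin n) K L) (c : Fin n → K) (i j : Fin n) :
    lieD (b.constr K c) (b i) (b j) = -∑ k, structureConstants b (i, j, k) * c k := by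
  simp [lieD, structureConstants, Module.Basis.constr_apply_fintype, Module.Basis.equivFun_apply]

theorem Module.Dual.eq_constr {K : Type*} [CommRing K] {L : Type*} [AddCommGroup L] [Module K L]
    {n : ℕ} (b : Module.Basis (Fin n) K L) (ω : Module.Dual K L) :
    ω = b.constr K fun i => ω (b i) :=
  b.ext fun i => by simp

theorem IsFormalDeformation.isFrobeniusian {L G : Type*} [LieRing L] [LieAlgebra ℂ L] [LieRing G]
    [LieAlgebra (PowerSeries ℂ) G] {p : ℕ} (hp : 1 ≤ p) (hL : IsFrobeniusian ℂ L p)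
    (h : IsFormalDeformation L G) : IsFrobeniusian (PowerSeries ℂ) G p := by
  obtain ⟨n, b, B, hB⟩ := h
  obtain ⟨_, hn, ω, -, x, hx⟩ := hL
  obtain rfl : n = 2 * p := by rw [← hn, Module.finrank_eq_card_basis b, Fintype.card_fin]
  let e : Fin (2 * p) ≃ Fin p × Fin 2 := Fintype.equivOfCardEq (by simp [mul_comm])
  replace hx := wedgePow_lieD_basis_ne_zero hx (b.reindex e)
  -- The form `ω` is lifted with constant power series as coordinates; the constant term of the
  -- resulting power is the power for `ω`.
  have key : wedgePow (lieD (B.constr (PowerSeries ℂ) fun i => PowerSeries.C (ω (b i)))) p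
      (B.reindex e) ≠ 0 := by
    intro h0
    apply hx
    rw [← map_wedgePow (PowerSeries.constantCoeff (R := ℂ)) (x := B.reindex e), h0, map_zero]
    intro i j
    rw [Module.Basis.reindex_apply, Module.Basis.reindex_apply, Module.Basis.reindex_apply,
      Module.Basis.reindex_apply, lieD_constr, Module.Dual.eq_constr b ω, lieD_constr]
    simp [hB]
  exact ⟨Module.Finite.of_basis B, by rw [Module.finrank_eq_card_basis B, Fintype.card_fin], _,
    ne_zero_of_wedgePow_lieD_ne_zero hp key, _, key⟩

/-- The exterior power of the differential of the linear form with coordinates `c`, as a polynomial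
in the structure constants. -/
noncomputable def wedgePowPolynomial {p n : ℕ} (e : Fin n ≃ Fin p × Fin 2) (c : Fin n → ℂ) :
    MvPolynomial (Fin n × Fin n × Fin n) ℂ :=
  wedgePow (fun i j => -∑ k, MvPolynomial.X (i, j, k) * MvPolynomial.C (c k)) p e.symm

theorem eval_wedgePowPolynomial {L : Type*} [LieRing L] [LieAlgebra ℂ L] {p n : ℕ}
    (e : Fin n ≃ Fin p × Fin 2) (c : Fin n → ℂ) (b : Module.Basis (Fin n) ℂ L) :
    MvPolynomial.eval (structureConstants b) (wedgePowPolynomial e c) =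
      wedgePow (lieD (b.constr ℂ c)) p (b.reindex e) := by
  refine map_wedgePow (MvPolynomial.eval (structureConstants b)) ?_
  intro i j
  rw [Module.Basis.reindex_apply, Module.Basis.reindex_apply, lieD_constr]
  simp

theorem IsFrobeniusian.exists_polynomial {L : Type*} [LieRing L] [LieAlgebra ℂ L] {p : ℕ}
    (hp : 1 ≤ p) (hL : IsFrobeniusian ℂ L p) (b : Module.Basis (Fin (2 * p)) ℂ L) :
    ∃ P : MvPolynomial (Fin (2 * p) × Fin (2 * p) × Fin (2 * p)) ℂ,
      MvPolynomial.eval (structureConstants b) P ≠ 0 ∧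
      ∀ (L' : Type u) [LieRing L'] [LieAlgebra ℂ L'] (b' : Module.Basis (Fin (2 * p)) ℂ L'),
        MvPolynomial.eval (structureConstants b') P ≠ 0 → IsFrobeniusian ℂ L' p := by
  obtain ⟨_, hn, ω, -, x, hx⟩ := hL
  let e : Fin (2 * p) ≃ Fin p × Fin 2 := Fintype.equivOfCardEq (by simp [mul_comm])
  refine ⟨wedgePowPolynomial e fun i => ω (b i), ?_, ?_⟩
  · rw [eval_wedgePowPolynomial, ← Module.Dual.eq_constr]
    exact wedgePow_lieD_basis_ne_zero hx (b.reindex e)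
  · intro L' _ _ b' h
    rw [eval_wedgePowPolynomial] at h
    exact ⟨Module.Finite.of_basis b', by rw [Module.finrank_eq_card_basis b', Fintype.card_fin],
      _, ne_zero_of_wedgePow_lieD_ne_zero hp h, _, h⟩

/-! ### The spectrum of `ad` in a model. -/

/-- A permutation cannot strictly raise the level at each index it moves, because the sum of the
levels is unchanged. So only the identity contributes to the determinant. -/
theorem Matrix.det_eq_prod_diag_of_level {ι : Type*} [Fintype ι] [DecidableEq ι]
    {M : Matrix ι ι ℂ} (level : ι → ℕ) (h : ∀ i j, i ≠ j → level i ≤ level j → M i j = 0) :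
    M.det = ∏ i, M i i := by
  rw [Matrix.det_apply, Finset.sum_eq_single 1]
  · simp
  · intro σ _ hσ
    obtain ⟨i, hi, hle⟩ : ∃ i, σ i ≠ i ∧ level (σ i) ≤ level i := by
      by_contra! hlt
      obtain ⟨i, hi⟩ : ∃ i, σ i ≠ i := by
        by_contra! h1
        exact hσ (Equiv.ext h1)
      have : ∑ j, level j < ∑ j, level (σ j) := by
        refine Finset.sum_lt_sum (fun j _ => ?_) ⟨i, Finset.mem_univ i, hlt i hi⟩
        by_cases hj : σ j = j
        · rw [hj]
        · exact (hlt j hj).le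
      rw [Equiv.sum_comp σ level] at this
      exact lt_irrefl _ this
    have hz : M (σ i) i = 0 := h _ _ hi hle
    have hp : ∏ j, M (σ j) j = 0 := Finset.prod_eq_zero (Finset.mem_univ i) hz
    rw [hp, smul_zero]
  · simp

namespace FrobModel
variable {m : ℕ}

/-- The eigenvalues of `ad X₂`, where `X₂` is dual to `ω₂`. -/
def weight (a : Fin m → ℂ) : AdaptedIndex m → ℂ
  | .inl 0 => 1
  | .inl 1 => 0
  | .inr (k, 0) => -a k
  | .inr (k, 1) => 1 + a k

/-- A filtration of the standard basis that all `ad x` respect. -/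
def level : AdaptedIndex m → ℕ
  | .inl 0 => 2
  | .inl 1 => 0
  | .inr _ => 1

/-- The matrix of `ad x` in the standard basis. -/
theorem toMatrix_ad_apply (a : Fin m → ℂ) (x : FrobModel a) (i j : AdaptedIndex m) :
    LinearMap.toMatrix (stdBasis a) (stdBasis a) (LieAlgebra.ad ℂ (FrobModel a) x) i j =
      -maurerCartanForm a i x (stdBasis a j) := by
  rw [LinearMap.toMatrix_apply, stdBasis_repr, LieAlgebra.ad_apply, lie_apply]

theorem toMatrix_ad_diag (a : Fin m → ℂ) (x : FrobModel a) (i : AdaptedIndex m) :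
    LinearMap.toMatrix (stdBasis a) (stdBasis a) (LieAlgebra.ad ℂ (FrobModel a) x) i i =
      x (.inl 1) * weight a i := by
  rw [toMatrix_ad_apply]
  rcases i with i | ⟨k, i⟩ <;> fin_cases i <;>
    simp [maurerCartanForm, coordWedge, stdBasis_apply, weight] <;> ring

theorem toMatrix_ad_of_level_le (a : Fin m → ℂ) (x : FrobModel a) {i j : AdaptedIndex m}
    (hij : i ≠ j) (h : level i ≤ level j) :
    LinearMap.toMatrix (stdBasis a) (stdBasis a) (LieAlgebra.ad ℂ (FrobModel a) x) i j = 0 := by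
  rw [toMatrix_ad_apply]
  rcases i with i | ⟨k, i⟩ <;> rcases j with j | ⟨l, j⟩ <;> fin_cases i <;> fin_cases j <;>
    simp_all [maurerCartanForm, coordWedge, stdBasis_apply, level]

theorem det_sub_ad (a : Fin m → ℂ) (x : FrobModel a) (T : ℂ) :
    LinearMap.det (T • LinearMap.id - LieAlgebra.ad ℂ (FrobModel a) x) =
      ∏ i, (T - x (.inl 1) * weight a i) := by
  rw [← LinearMap.det_toMatrix (stdBasis a), map_sub, map_smul, LinearMap.toMatrix_id,
    Matrix.det_eq_prod_diag_of_level level]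
  · simp [toMatrix_ad_diag]
  · intro i j hij h
    simp [toMatrix_ad_of_level_le a x hij h, hij]

/-- Each of the `m + 1` pairs of weights, `1, 0` and `-a k, 1 + a k`, has sum `1`. The independence
from `a` is what lets the trace fix the scale of `x` in a contraction. -/
theorem trace_ad (a : Fin m → ℂ) (x : FrobModel a) :
    LinearMap.trace ℂ _ (LieAlgebra.ad ℂ (FrobModel a) x) = x (.inl 1) * (m + 1) := by
  rw [LinearMap.trace_eq_matrix_trace ℂ (stdBasis a), Matrix.trace]
  simp only [Matrix.diag_apply, toMatrix_ad_diag]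
  rw [← Finset.mul_sum]
  congr 1
  simp [Fintype.sum_sum_type, Fintype.sum_prod_type, weight, add_comm]

theorem prod_weight (a : Fin m → ℂ) (T : ℂ) :
    ∏ i, (T - weight a i) = (T ^ 2 - T) * ∏ k, (T ^ 2 - T - a k * (1 + a k)) := by
  simp only [Fintype.prod_sum_type, Fintype.prod_prod_type, weight, Fin.prod_univ_two]
  congr 1
  · ring
  · exact Finset.prod_congr rfl fun k _ => by ring

end FrobModel

/-! ### Recovering the parameters, and isomorphisms between models. -/

/-- Two families with the same multiset of values differ by a permutation. -/
theorem exists_perm_of_map_univ_eq {ι α : Type*} [Fintype ι] {f g : ι → α}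
    (h : Finset.univ.val.map f = Finset.univ.val.map g) :
    ∃ σ : Equiv.Perm ι, ∀ i, f (σ i) = g i := by
  classical
  have hc : ∀ c, Fintype.card {i // g i = c} = Fintype.card {i // f i = c} := by
    intro c
    have := congrArg (Multiset.count c) h
    rw [Multiset.count_map, Multiset.count_map] at this
    rw [Fintype.card_subtype, Fintype.card_subtype]
    simpa [Finset.card, eq_comm] using this.symm
  have e := fun c => Fintype.equivOfCardEq (hc c)
  refine ⟨(Equiv.sigmaFiberEquiv g).symm.trans
    ((Equiv.sigmaCongrRight fun c => e c).trans (Equiv.sigmaFiberEquiv f)), fun i => ?_⟩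
  exact (e (g i) ⟨i, rfl⟩).2

/-- Both sides are polynomials in `u = T ^ 2 - T`, and `u` takes every complex value. The identity
thus holds between polynomials in `u`, and their roots can be compared after cancelling the factor
`u`. -/
theorem exists_perm_of_prod_eq {m : ℕ} {g g' : Fin m → ℂ}
    (h : ∀ T : ℂ, (T ^ 2 - T) * ∏ k, (T ^ 2 - T - g k) = (T ^ 2 - T) * ∏ k, (T ^ 2 - T - g' k)) :
    ∃ σ : Equiv.Perm (Fin m), ∀ k, g (σ k) = g' k := by
  apply exists_perm_of_map_univ_eq
  have hsurj : ∀ u : ℂ, ∃ T : ℂ, T ^ 2 - T = u := by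
    intro u
    obtain ⟨s, hs⟩ := IsAlgClosed.exists_pow_nat_eq (1 + 4 * u) (n := 2) two_pos
    exact ⟨(1 + s) / 2, by linear_combination hs / 4⟩
  open Polynomial in
  have hpoly : (X : ℂ[X]) * ∏ k, (X - C (g k)) = X * ∏ k, (X - C (g' k)) := by
    refine Polynomial.funext fun u => ?_
    obtain ⟨T, rfl⟩ := hsurj u
    simpa [eval_prod] using h T
  have hroots := congrArg Polynomial.roots (mul_left_cancel₀ Polynomial.X_ne_zero hpoly)
  have hr : ∀ f : Fin m → ℂ, (∏ k, (Polynomial.X - Polynomial.C (f k))).roots =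
      Finset.univ.val.map f := by
    intro f
    rw [← Polynomial.roots_multiset_prod_X_sub_C (Finset.univ.val.map f), Multiset.map_map]
    rfl
  rwa [hr, hr] at hroots

namespace FrobModel
variable {m : ℕ}

/-- The pairs `(ω₂ₖ₊₁, ω₂ₖ₊₂)` may be permuted, and in each of them `a k` may be replaced by
`-(1 + a k)`. -/
theorem nonempty_lieEquiv {a a' : Fin m → ℂ} (σ : Equiv.Perm (Fin m))
    (h : ∀ k, a (σ k) * (1 + a (σ k)) = a' k * (1 + a' k)) :
    Nonempty (FrobModel a ≃ₗ⁅ℂ⁆ FrobModel a') := by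
  -- The quadratic `s * (1 + s) = const` has the two roots `s` and `-(1 + s)`.
  have h' : ∀ k, a' k ≠ a (σ k) → a' k = -(1 + a (σ k)) := by
    intro k hk
    have : (a' k - a (σ k)) * (a' k + (1 + a (σ k))) = 0 := by linear_combination -h k
    exact eq_neg_of_add_eq_zero_left ((mul_eq_zero.1 this).resolve_left (sub_ne_zero.2 hk))
  -- The two coordinates of a pair are interchanged when its parameter is replaced by the other
  -- root; the minus sign keeps the term `ω₂ₖ₊₁ ∧ ω₂ₖ₊₂` of `dω₁` unchanged.
  obtain ⟨F, hF, hF0, hF1⟩ : ∃ F : FrobModel a → FrobModel a',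
      (∀ x i, F x (.inl i) = x (.inl i)) ∧
      (∀ x k, F x (.inr (k, 0)) =
        if a' k = a (σ k) then x (.inr (σ k, 0)) else x (.inr (σ k, 1))) ∧
      (∀ x k, F x (.inr (k, 1)) =
        if a' k = a (σ k) then x (.inr (σ k, 1)) else -x (.inr (σ k, 0))) :=
    ⟨fun x i => match i with
      | .inl i => x (.inl i)
      | .inr (k, 0) => if a' k = a (σ k) then x (.inr (σ k, 0)) else x (.inr (σ k, 1))
      | .inr (k, 1) => if a' k = a (σ k) then x (.inr (σ k, 1)) else -x (.inr (σ k, 0)),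
      fun _ _ => rfl, fun _ _ => rfl, fun _ _ => rfl⟩
  let f : FrobModel a →ₗ[ℂ] FrobModel a' :=
    { toFun := F
      map_add' := by
        intro x y
        funext i
        rcases i with i | ⟨k, i⟩ <;> fin_cases i <;> simp only [add_apply, Fin.zero_eta,
          Fin.mk_one, hF, hF0, hF1]
        all_goals split_ifs <;> ring
      map_smul' := by
        intro c x
        funext i
        rcases i with i | ⟨k, i⟩ <;> fin_cases i <;> simp only [smul_apply, Fin.zero_eta,
          Fin.mk_one, hF, hF0, hF1, RingHom.id_apply]
        all_goals split_ifs <;> ring }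
  have hlie : ∀ x y : FrobModel a, F ⁅x, y⁆ = ⁅F x, F y⁆ := by
    intro x y
    funext i
    rcases i with i | ⟨k, i⟩
    · rw [hF, lie_apply, lie_apply]
      fin_cases i
      · simp only [maurerCartanForm, coordWedge, hF, hF0, hF1]
        rw [← Equiv.sum_comp σ]
        congr 2
        refine Finset.sum_congr rfl fun k _ => ?_
        split_ifs <;> ring
      · rfl
    · fin_cases i <;> simp only [Fin.zero_eta, Fin.mk_one, hF0, hF1, lie_apply,
        maurerCartanForm, coordWedge, hF]
      all_goals
        split_ifs with hk
        · rw [hk]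
        · rw [h' k hk] <;> ring
  have hinj : Function.Injective f := by
    rw [injective_iff_map_eq_zero]
    intro x hx
    have hx' : ∀ i, F x i = 0 := fun i => congrFun hx i
    funext i
    rcases i with i | ⟨k, i⟩
    · exact (hF x i).symm.trans (hx' (.inl i))
    · have h0 := hx' (.inr (σ.symm k, 0))
      have h1 := hx' (.inr (σ.symm k, 1))
      rw [hF0, Equiv.apply_symm_apply] at h0
      rw [hF1, Equiv.apply_symm_apply] at h1
      rw [zero_apply]
      by_cases hk : a' (σ.symm k) = a k
      · fin_cases i <;> simp_all
      · fin_cases i <;> simp_all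
  have hfr : Module.finrank ℂ (FrobModel a) = Module.finrank ℂ (FrobModel a') := by
    rw [finrank_eq, finrank_eq]
  exact ⟨LieEquiv.ofBijective { f with map_lie' := fun {x y} => hlie x y }
    ⟨hinj, (LinearMap.injective_iff_surjective_of_finrank_eq_finrank hfr).1 hinj⟩⟩

end FrobModel

/-! ### Invariants of contractions, and rigidity within the family. -/

/-- The characteristic polynomial of `ad` is continuous along a contraction. -/
theorem ContractsOnto.exists_tendsto {L L' : Type*} [LieRing L] [LieAlgebra ℂ L] [LieRing L']
    [LieAlgebra ℂ L'] [Module.Finite ℂ L'] (h : ContractsOnto L L') (x : L') :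
    ∃ y : ℝ → L,
      Tendsto (fun t => LinearMap.trace ℂ L (LieAlgebra.ad ℂ L (y t))) (𝓝[>] 0)
        (𝓝 (LinearMap.trace ℂ L' (LieAlgebra.ad ℂ L' x))) ∧
      ∀ T : ℂ, Tendsto (fun t => LinearMap.det (T • LinearMap.id - LieAlgebra.ad ℂ L (y t)))
        (𝓝[>] 0) (𝓝 (LinearMap.det (T • LinearMap.id - LieAlgebra.ad ℂ L' x))) := by
  obtain ⟨f, hf⟩ := h
  let b := Module.finBasis ℂ L'
  have hconj : ∀ t, (f t).symm.conj (LieAlgebra.ad ℂ L (f t x)) =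
      (f t).symm.toLinearMap ∘ₗ (LieAlgebra.ad ℂ L (f t x)) ∘ₗ (f t).toLinearMap := fun t => rfl
  -- For the transported bracket, `ad x` is the conjugate by `f t` of `ad (f t x)`, so it has the
  -- trace and determinants of the latter; its matrix entries converge by hypothesis.
  have hmat : Tendsto (fun t => LinearMap.toMatrix b b
      ((f t).symm.conj (LieAlgebra.ad ℂ L (f t x)))) (𝓝[>] 0)
      (𝓝 (LinearMap.toMatrix b b (LieAlgebra.ad ℂ L' x))) := by
    refine tendsto_pi_nhds.2 fun i => tendsto_pi_nhds.2 fun j => ?_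
    simpa [LinearMap.toMatrix_apply, hconj] using hf x (b j) (b.coord i)
  refine ⟨fun t => f t x, ?_, fun T => ?_⟩
  · have := (Continuous.matrix_trace continuous_id).continuousAt.tendsto.comp hmat
    simpa [Function.comp_def, ← LinearMap.trace_eq_matrix_trace, LinearMap.trace_conj'] using this
  · have hc : Continuous fun A : Matrix (Fin (Module.finrank ℂ L')) (Fin (Module.finrank ℂ L')) ℂ =>
        (T • (1 : Matrix _ _ ℂ) - A).det :=
      Continuous.matrix_det (continuous_const.sub continuous_id)
    have := hc.continuousAt.tendsto.comp hmat
    have hd : ∀ g : Module.End ℂ L', (T • (1 : Matrix _ _ ℂ) - LinearMap.toMatrix b b g).det =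
        LinearMap.det (T • LinearMap.id - g) := by
      intro g
      rw [← LinearMap.det_toMatrix b, map_sub, map_smul, LinearMap.toMatrix_id]
    have hd' : ∀ t, LinearMap.det (T • LinearMap.id - (f t).symm.conj
        (LieAlgebra.ad ℂ L (f t x))) =
        LinearMap.det (T • LinearMap.id - LieAlgebra.ad ℂ L (f t x)) := by
      intro t
      rw [← LinearMap.det_conj (T • LinearMap.id - LieAlgebra.ad ℂ L (f t x)) (f t).symm]
      congr 1
      ext z
      simp [LinearEquiv.conj_apply]
    simpa [Function.comp_def, hd, hd'] using this

theorem FrobModel.nonempty_lieEquiv_of_contractsOnto {m : ℕ} {a a' : Fin m → ℂ}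
    (h : ContractsOnto (FrobModel a) (FrobModel a')) :
    Nonempty (FrobModel a ≃ₗ⁅ℂ⁆ FrobModel a') := by
  -- The vector dual to `ω₂` has trace `m + 1`, so the traces force the `ω₂`-coordinate of `y t` to
  -- tend to `1`. The limit polynomial is then also the one of the corresponding vector of
  -- `FrobModel a`.
  obtain ⟨y, htr, hdet⟩ := h.exists_tendsto (FrobModel.stdBasis a' (.inl 1))
  simp only [FrobModel.trace_ad, FrobModel.det_sub_ad, FrobModel.stdBasis_apply, if_true,
    one_mul] at htr hdet
  have hm : (m + 1 : ℂ) ≠ 0 := by exact_mod_cast Nat.succ_ne_zero m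
  have hs : Tendsto (fun t => y t (.inl 1)) (𝓝[>] 0) (𝓝 1) := by
    simpa [hm] using htr.div_const (m + 1 : ℂ)
  obtain ⟨σ, hσ⟩ := exists_perm_of_prod_eq (g := fun k => a k * (1 + a k))
    (g' := fun k => a' k * (1 + a' k)) fun T => by
      rw [← FrobModel.prod_weight, ← FrobModel.prod_weight]
      refine tendsto_nhds_unique ?_ (hdet T)
      have : Tendsto (fun t => ∏ i, (T - y t (.inl 1) * FrobModel.weight a i)) (𝓝[>] 0)
          (𝓝 (∏ i, (T - 1 * FrobModel.weight a i))) :=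
        tendsto_finsetProd _ fun i _ => tendsto_const_nhds.sub (hs.mul_const _)
      simpa using this
  exact FrobModel.nonempty_lieEquiv σ hσ

/-! ### Contractions by diagonal rescaling. -/

/-- Rescaling `b i` by `t ^ w i` multiplies the structure constant at `(i, j, k)` by `t ^ (w i + w j
- w k)`. It tends to zero when the exponent is positive, stays when the exponent is zero, and
otherwise must vanish from the start. -/
theorem contractsOnto_of_weights {L L' ι : Type*} [LieRing L] [LieAlgebra ℂ L] [LieRing L']
    [LieAlgebra ℂ L'] [Fintype ι] (b : Module.Basis ι ℂ L)
    (b' : Module.Basis ι ℂ L') (w : ι → ℕ)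
    (h : ∀ i j k, (w k < w i + w j ∧ b'.repr ⁅b' i, b' j⁆ k = 0) ∨
      (w k = w i + w j ∧ b.repr ⁅b i, b j⁆ k = b'.repr ⁅b' i, b' j⁆ k) ∨
      (b.repr ⁅b i, b j⁆ k = 0 ∧ b'.repr ⁅b' i, b' j⁆ k = 0)) :
    ContractsOnto L L' := by
  let s : ℝ → ℂˣ := fun t => if ht : (t : ℂ) ≠ 0 then Units.mk0 (t : ℂ) ht else 1
  have hs : ∀ t : ℝ, 0 < t → (s t : ℂ) = t := fun t ht => by
    have : (t : ℂ) ≠ 0 := Complex.ofReal_ne_zero.2 ht.ne'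
    simp [s, ht.ne']
  let c : ℝ → Module.Basis ι ℂ L := fun t => b.unitsSMul fun i => s t ^ w i
  refine ⟨fun t => b'.equiv (c t) (Equiv.refl ι), ?_⟩
  have hbasis : ∀ i j k, Tendsto (fun t => b'.repr ((b'.equiv (c t) (Equiv.refl ι)).symm
      ⁅b'.equiv (c t) (Equiv.refl ι) (b' i), b'.equiv (c t) (Equiv.refl ι) (b' j)⁆) k) (𝓝[>] 0)
      (𝓝 (b'.repr ⁅b' i, b' j⁆ k)) := by
    intro i j k
    have hrepr : ∀ t (z : L), b'.repr ((b'.equiv (c t) (Equiv.refl ι)).symm z) k =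
        (c t).repr z k := by
      intro t z
      simp [Module.Basis.equiv]
    have heq : ∀ t : ℝ, 0 < t → b'.repr ((b'.equiv (c t) (Equiv.refl ι)).symm
        ⁅b'.equiv (c t) (Equiv.refl ι) (b' i), b'.equiv (c t) (Equiv.refl ι) (b' j)⁆) k =
        ((t : ℂ) ^ w k)⁻¹ * (t : ℂ) ^ (w i + w j) * b.repr ⁅b i, b j⁆ k := by
      intro t ht
      rw [hrepr]
      simp only [Module.Basis.equiv_apply, Equiv.refl_apply, c, Module.Basis.repr_unitsSMul,
        Module.Basis.unitsSMul_apply, Units.smul_def, smul_lie, lie_smul, map_smul,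
        Finsupp.smul_apply, smul_eq_mul, Units.val_inv_eq_inv_val, Units.val_pow_eq_pow_val, hs t ht]
      ring
    have hev : ∀ᶠ t : ℝ in 𝓝[>] 0, 0 < t := self_mem_nhdsWithin
    rcases h i j k with ⟨hw, h0⟩ | ⟨hw, h1⟩ | ⟨h0, h1⟩
    · rw [h0]
      have h2 : Tendsto (fun t : ℝ => (t : ℂ) ^ (w i + w j - w k) * b.repr ⁅b i, b j⁆ k)
          (𝓝[>] 0) (𝓝 0) := by
        have hc : Continuous fun t : ℝ =>
            (t : ℂ) ^ (w i + w j - w k) * b.repr ⁅b i, b j⁆ k := by fun_prop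
        have := hc.tendsto 0
        rw [Complex.ofReal_zero, zero_pow (by omega), zero_mul] at this
        exact this.mono_left nhdsWithin_le_nhds
      refine h2.congr' ?_
      filter_upwards [hev] with t ht
      have ht' : (t : ℂ) ≠ 0 := Complex.ofReal_ne_zero.2 ht.ne'
      rw [heq t ht, pow_sub₀ _ ht' hw.le, mul_comm ((t : ℂ) ^ (w i + w j))]
    · refine tendsto_const_nhds.congr' ?_
      filter_upwards [hev] with t ht
      have ht' : (t : ℂ) ≠ 0 := Complex.ofReal_ne_zero.2 ht.ne'
      rw [heq t ht, ← hw, inv_mul_cancel₀ (pow_ne_zero _ ht'), one_mul, h1]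
    · refine tendsto_const_nhds.congr' ?_
      filter_upwards [hev] with t ht
      rw [heq t ht, h0, h1, mul_zero]
  intro x y φ
  have hφ : ∀ z, φ z = ∑ k, b'.repr z k * φ (b' k) := fun z => by
    conv_lhs => rw [← b'.sum_repr z]
    simp only [map_sum, map_smul, smul_eq_mul]
  rw [← b'.sum_repr x, ← b'.sum_repr y]
  simp only [map_sum, map_smul, sum_lie, lie_sum, smul_lie, lie_smul,
    smul_eq_mul]
  refine tendsto_finsetSum _ fun i _ => Tendsto.const_mul _ (tendsto_finsetSum _ fun j _ =>
    Tendsto.const_mul _ ?_)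
  have := tendsto_finsetSum Finset.univ fun k _ => (hbasis j i k).mul_const (φ (b' k))
  simpa only [← hφ] using this

/-! ### Symplectic linear algebra and triangular symplectic bases. -/

section Symplectic
variable {V : Type u} [AddCommGroup V] [Module ℂ V]

/-- The common orthogonal of two vectors. -/
def orthogonalPair (B : V →ₗ[ℂ] V →ₗ[ℂ] ℂ) (v w : V) : Submodule ℂ V :=
  LinearMap.ker ((B v).prod (B w))

theorem mem_orthogonalPair {B : V →ₗ[ℂ] V →ₗ[ℂ] ℂ} {v w x : V} :
    x ∈ orthogonalPair B v w ↔ B v x = 0 ∧ B w x = 0 := by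
  simp [orthogonalPair]

variable {B : V →ₗ[ℂ] V →ₗ[ℂ] ℂ}

theorem neg_apply_of_self_eq_zero (hB : ∀ x, B x x = 0) (x y : V) : B y x = -B x y := by
  have := hB (x + y)
  simp only [map_add, LinearMap.add_apply, hB, zero_add, add_zero] at this
  linear_combination this

theorem finrank_orthogonalPair [Module.Finite ℂ V] (hB : ∀ x, B x x = 0) {v w : V}
    (hvw : B v w = 1) :
    Module.finrank ℂ (orthogonalPair B v w) + 2 = Module.finrank ℂ V := by
  have hsurj : LinearMap.range ((B v).prod (B w)) = ⊤ := by
    rw [LinearMap.range_eq_top]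
    rintro ⟨s, t⟩
    refine ⟨s • w - t • v, ?_⟩
    simp [hB, hvw, neg_apply_of_self_eq_zero hB v w]
  have := LinearMap.finrank_range_add_finrank_ker ((B v).prod (B w))
  rw [hsurj, finrank_top, Module.finrank_prod, Module.finrank_self] at this
  rw [orthogonalPair]
  omega

theorem orthogonalPair_nondegenerate (hB : ∀ x, B x x = 0) (hnd : ∀ x, (∀ y, B x y = 0) → x = 0)
    {v w : V} (hvw : B v w = 1) (x : orthogonalPair B v w)
    (hx : ∀ y : orthogonalPair B v w, B x y = 0) : x = 0 := by
  obtain ⟨x, hxm⟩ := x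
  obtain ⟨h1, h2⟩ := mem_orthogonalPair.1 hxm
  ext
  refine hnd x fun z => ?_
  -- The projection of `z` along the plane of `v` and `w`; since `x` is orthogonal to that plane,
  -- pairing with `x` does not see the correction.
  have hz : z - B z w • v + B z v • w ∈ orthogonalPair B v w := by
    rw [mem_orthogonalPair]
    simp [hB, hvw, neg_apply_of_self_eq_zero hB v w, neg_apply_of_self_eq_zero hB v z,
      neg_apply_of_self_eq_zero hB w z]
  have := hx ⟨_, hz⟩
  simpa [neg_apply_of_self_eq_zero hB v x, neg_apply_of_self_eq_zero hB w x, h1, h2] using this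

theorem exists_eq_of_nondegenerate [Module.Finite ℂ V] (hnd : ∀ x, (∀ y, B x y = 0) → x = 0) :
    ∃ e : V ≃ₗ[ℂ] Module.Dual ℂ V, ∀ x, e x = B x := by
  have hinj : Function.Injective (B : V →ₗ[ℂ] Module.Dual ℂ V) := by
    rw [injective_iff_map_eq_zero]
    exact fun x hx => hnd x fun y => by rw [hx]; rfl
  exact ⟨LinearEquiv.ofInjectiveOfFinrankEq B hinj Subspace.dual_finrank_eq.symm, fun _ => rfl⟩

/-- The vector is an eigenvector of the endomorphism `B⁻¹ M`. -/
theorem exists_apply_eq_smul [Module.Finite ℂ V] [Nontrivial V]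
    (hnd : ∀ x, (∀ y, B x y = 0) → x = 0) (M : V →ₗ[ℂ] V →ₗ[ℂ] ℂ) :
    ∃ (v : V) (l : ℂ), v ≠ 0 ∧ ∀ y, M v y = l * B v y := by
  obtain ⟨e, he⟩ := exists_eq_of_nondegenerate hnd
  obtain ⟨l, hl⟩ := Module.End.exists_eigenvalue (e.symm.toLinearMap ∘ₗ M)
  obtain ⟨v, hv⟩ := hl.exists_hasEigenvector
  refine ⟨v, l, hv.2, fun y => ?_⟩
  have h1 : e.symm (M v) = l • v := hv.apply_eq_smul
  rw [LinearEquiv.symm_apply_eq, map_smul, he] at h1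
  rw [h1]
  rfl

/-- A bilinear form `M` whose antisymmetrization is a multiple of a symplectic form `B` is
triangular in some symplectic basis. -/
theorem exists_symplectic_triangular (c : ℂ) (m : ℕ) :
    ∀ (V : Type u) [AddCommGroup V] [Module ℂ V] [Module.Finite ℂ V] (B M : V →ₗ[ℂ] V →ₗ[ℂ] ℂ),
      (∀ x, B x x = 0) → (∀ x, (∀ y, B x y = 0) → x = 0) →
      (∀ x y, M x y - M y x = c * B x y) → Module.finrank ℂ V = 2 * m →
      ∃ e : Fin m × Fin 2 → V, (∀ i j, B (e i) (e j) = symplecticGram i j) ∧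
        (∀ i j, M (e (i, 0)) (e (j, 0)) = 0) ∧ ∀ i j, i < j → M (e (i, 0)) (e (j, 1)) = 0 := by
  induction m with
  | zero =>
    intro V _ _ _ B M _ _ _ _
    exact ⟨fun i => i.1.elim0, fun i => i.1.elim0, fun i => i.elim0, fun i => i.elim0⟩
  | succ m ih =>
    intro V _ _ _ B M hB hnd hM hV
    have : Nontrivial V := Module.nontrivial_of_finrank_pos (R := ℂ) (by omega)
    -- As `M v` is proportional to `B v`, it vanishes on the orthogonal of `v`; by the
    -- antisymmetrization hypothesis `M x v` vanishes there as well. So `v` can open the basis, with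
    -- induction on the orthogonal of `v` and a partner `w`. Nothing is known about `M x w`, hence
    -- the condition `i < j` in the conclusion.
    obtain ⟨v, l, hv, hl⟩ := exists_apply_eq_smul hnd M
    obtain ⟨w₀, hw₀⟩ : ∃ w, B v w ≠ 0 := by
      by_contra! h
      exact hv (hnd v h)
    obtain ⟨w, hw⟩ : ∃ w, B v w = 1 := ⟨(B v w₀)⁻¹ • w₀, by simp [hw₀]⟩
    have hwv : B w v = -1 := by rw [neg_apply_of_self_eq_zero hB v w, hw]
    let U := orthogonalPair B v w
    obtain ⟨e, he, h0, h1⟩ := ih U (B.domRestrict₁₂ U U) (M.domRestrict₁₂ U U)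
      (fun x => hB x) (orthogonalPair_nondegenerate hB hnd hw) (fun x y => hM x y)
      (by
        have : Module.finrank ℂ U + 2 = Module.finrank ℂ V := finrank_orthogonalPair hB hw
        omega)
    simp only [LinearMap.domRestrict₁₂_apply] at he h0 h1
    have hve : ∀ i, B v (e i) = 0 := fun i => (mem_orthogonalPair.1 (e i).2).1
    have hwe : ∀ i, B w (e i) = 0 := fun i => (mem_orthogonalPair.1 (e i).2).2
    have hev : ∀ i, B (e i) v = 0 := fun i => by simp [neg_apply_of_self_eq_zero hB v, hve]
    have hew : ∀ i, B (e i) w = 0 := fun i => by simp [neg_apply_of_self_eq_zero hB w, hwe]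
    let g : Fin (m + 1) → Fin 2 → V := Fin.cons ![v, w] fun k i => e (k, i)
    have g0 : g 0 = ![v, w] := rfl
    have gs : ∀ k i, g (Fin.succ k) i = e (k, i) := fun _ _ => rfl
    refine ⟨fun i => g i.1 i.2, ?_, ?_, ?_⟩
    · rintro ⟨k, i⟩ ⟨k', j⟩
      refine Fin.cases ?_ (fun k => ?_) k <;> refine Fin.cases ?_ (fun k' => ?_) k'
      · fin_cases i <;> fin_cases j <;> simp [g0, hB, hw, hwv, symplecticGram]
      · fin_cases i <;> simp [g0, gs, hve, hwe, symplecticGram, (Fin.succ_ne_zero k').symm]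
      · fin_cases j <;> simp [g0, gs, hev, hew, symplecticGram]
      · simp [gs, he, symplecticGram]
    · intro k k'
      refine Fin.cases ?_ (fun k => ?_) k <;> refine Fin.cases ?_ (fun k' => ?_) k'
      · simp [g0, hl, hB]
      · simp [g0, gs, hl, hve]
      · have := hM v (e (k, 0))
        simpa [g0, gs, hl, hve] using this
      · simp [gs, h0]
    · intro k k'
      refine Fin.cases ?_ (fun k => ?_) k <;> refine Fin.cases ?_ (fun k' => ?_) k'
      · simp
      · simp [g0, gs, hl, hve]
      · simp
      · intro hlt
        simpa [gs] using h1 k k' (Fin.succ_lt_succ_iff.1 hlt)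

end Symplectic

/-! ### Every frobeniusian algebra contracts onto a model. -/

/-- Weights of a one-parameter group that contracts onto a member of the family. -/
def contractionWeight (m : ℕ) : AdaptedIndex m → ℕ
  | .inl 0 => 6 * m + 1
  | .inl 1 => 0
  | .inr (k, 0) => 2 * m + 1 + k
  | .inr (k, 1) => 4 * m - k

/-- With these bounds two such weights add up to more than any third one, so brackets of these
vectors keep only their component along the first basis vector. -/
theorem contractionWeight_inr_mem {m : ℕ} (i : Fin m × Fin 2) :
    2 * m + 1 ≤ contractionWeight m (.inr i) ∧ contractionWeight m (.inr i) ≤ 4 * m := by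
  obtain ⟨k, i⟩ := i
  fin_cases i <;> simp only [contractionWeight] <;> omega

theorem FrobModel.maurerCartanForm_stdBasis_inr {m : ℕ} (a : Fin m → ℂ) (i j : Fin m × Fin 2) :
    maurerCartanForm a (.inl 0) (FrobModel.stdBasis a (.inr i)) (FrobModel.stdBasis a (.inr j)) =
      symplecticGram i j := by
  obtain ⟨k, i⟩ := i
  obtain ⟨l, j⟩ := j
  by_cases h : k = l
  · subst h
    fin_cases i <;> fin_cases j <;> simp [maurerCartanForm, coordWedge,
      FrobModel.stdBasis_apply, symplecticGram, Prod.ext_iff]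
  · fin_cases i <;> fin_cases j <;> simp [maurerCartanForm, coordWedge,
      FrobModel.stdBasis_apply, symplecticGram, Prod.ext_iff, h, Ne.symm h, ← ite_and]

/-- The structure of a frobeniusian Lie algebra in a symplectic basis `b` for `dω` in which `ad X₂`
is triangular. -/
theorem IsFrobeniusian.exists_triangular_basis {L : Type u} [LieRing L] [LieAlgebra ℂ L] {m : ℕ}
    (h : IsFrobeniusian ℂ L (m + 1)) :
    ∃ (b : Module.Basis (AdaptedIndex m) ℂ L) (a : Fin m → ℂ),
      (∀ x, b.repr ⁅b (.inl 1), x⁆ (.inl 0) = b.repr x (.inl 0)) ∧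
      (∀ i j, b.repr ⁅b (.inr i), b (.inr j)⁆ (.inl 0) = -symplecticGram i j) ∧
      (∀ k l, b.repr ⁅b (.inl 1), b (.inr (k, 0))⁆ (.inr (l, 1)) = 0) ∧
      (∀ k l, k < l → b.repr ⁅b (.inl 1), b (.inr (k, 0))⁆ (.inr (l, 0)) = 0) ∧
      (∀ k, b.repr ⁅b (.inl 1), b (.inr (k, 0))⁆ (.inr (k, 0)) = -a k) ∧
      (∀ k l, l < k → b.repr ⁅b (.inl 1), b (.inr (k, 1))⁆ (.inr (l, 1)) = 0) ∧
      ∀ k, b.repr ⁅b (.inl 1), b (.inr (k, 1))⁆ (.inr (k, 1)) = 1 + a k := by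
  obtain ⟨_, hfin, ω, hω, x, hx⟩ := h
  let θ := lieDForm ω
  have hθ : ∀ x y, θ x y = -ω ⁅x, y⁆ := fun _ _ => rfl
  have hself : ∀ x, θ x x = 0 := lieDForm_self ω
  have hneg := neg_apply_of_self_eq_zero hself
  have hnd : ∀ x, (∀ y, θ x y = 0) → x = 0 := fun v hv =>
    eq_zero_of_wedgePow_ne_zero (θ := θ) (Nat.succ_pos m) hfin hx hself hv
  obtain ⟨E, hE⟩ := exists_eq_of_nondegenerate hnd
  -- This says `ω [v, x] = ω x`; `v` will play the role of the vector dual to `ω₂`.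
  obtain ⟨v, hv⟩ : ∃ v, ∀ x, θ x v = ω x := by
    refine ⟨E.symm (-ω), fun x => ?_⟩
    rw [hneg (E.symm (-ω)) x, ← hE, LinearEquiv.apply_symm_apply]
    simp
  have hωv : ω v = 0 := by rw [← hv, hself]
  obtain ⟨u, hu⟩ : ∃ u, ω u = 1 := by
    obtain ⟨u, hu⟩ : ∃ u, ω u ≠ 0 := by
      by_contra! h0
      exact hω (LinearMap.ext h0)
    exact ⟨(ω u)⁻¹ • u, by simp [hu]⟩
  have huv : θ u v = 1 := by rw [hv, hu]
  let M : L →ₗ[ℂ] L →ₗ[ℂ] ℂ := θ ∘ₗ LieAlgebra.ad ℂ L v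
  have hM' : ∀ x y, M x y = θ ⁅v, x⁆ y := fun _ _ => rfl
  have hM : ∀ x y, M x y - M y x = θ x y := by
    intro x y
    have h1 : ω ⁅v, ⁅x, y⁆⁆ = ω ⁅x, y⁆ := by
      rw [← neg_eq_iff_eq_neg.2 (hθ v ⁅x, y⁆), hneg ⁅x, y⁆ v, hv, neg_neg]
    rw [leibniz_lie, map_add, ← lie_skew x ⁅v, y⁆, map_neg] at h1
    rw [hM', hM', hθ, hθ, hθ]
    linear_combination -h1
  let U := orthogonalPair θ u v
  obtain ⟨e, he, h0, h1⟩ := exists_symplectic_triangular 1 m U (θ.domRestrict₁₂ U U)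
    (M.domRestrict₁₂ U U) (fun x => hself x) (orthogonalPair_nondegenerate hself hnd huv)
    (fun x y => (hM x y).trans (one_mul _).symm)
    (by
      have : Module.finrank ℂ U + 2 = Module.finrank ℂ L := finrank_orthogonalPair hself huv
      omega)
  simp only [LinearMap.domRestrict₁₂_apply] at he h0 h1
  have hue : ∀ i, θ u (e i) = 0 := fun i => (mem_orthogonalPair.1 (e i).2).1
  have hve : ∀ i, θ v (e i) = 0 := fun i => (mem_orthogonalPair.1 (e i).2).2
  have heω : ∀ i, ω (e i) = 0 := fun i => by rw [← hv, hneg v, hve, neg_zero]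
  let f : AdaptedIndex m → L := Sum.elim ![u, v] fun i => e i
  -- The family dual to `f`, written through `θ`: the coordinates of `[v, e i]` along the `e j`
  -- become, up to sign, values of `M`.
  let c : AdaptedIndex m → Module.Dual ℂ L :=
    Sum.elim ![ω, θ u] fun i => if i.2 = 0 then -θ (e (i.1, 1)) else θ (e (i.1, 0))
  have hc : ∀ i j, c i (f j) = if i = j then 1 else 0 := by
    rintro (i | ⟨k, i⟩) (j | ⟨l, j⟩)
    · fin_cases i <;> fin_cases j <;> simp [c, f, hu, hωv, hself, huv]
    · fin_cases i <;> simp [c, f, heω, hue]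
    · fin_cases i <;> fin_cases j <;> simp [c, f, hv, heω, hneg u, hue]
    · by_cases hkl : k = l <;> fin_cases i <;> fin_cases j <;>
        simp [c, f, he, symplecticGram, hkl]
  have hli : LinearIndependent ℂ f := by
    refine LinearIndependent.of_pairwise_dual_eq_zero_one f c ?_ ?_
    · intro i j hij
      simp [hc, hij]
    · intro i
      simp [hc]
  let b := basisOfLinearIndependentOfCardEqFinrank' f hli (by simp [hfin]; ring)
  have hb : ∀ i, b i = f i := fun i => by simp [b]
  have hrepr : ∀ x i, b.repr x i = c i x := by
    intro x i
    conv_rhs => rw [← b.sum_repr x]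
    simp only [map_sum, map_smul, hb, hc, smul_eq_mul, mul_ite, mul_one, mul_zero,
      Finset.sum_ite_eq, Finset.mem_univ, if_true]
  have hb1 : b (.inl 1) = v := hb _
  have hbr : ∀ i, b (.inr i) = e i := fun i => hb _
  have hc0 : c (.inl 0) = ω := rfl
  have hcr0 : ∀ k x, c (.inr (k, 0)) x = θ x (e (k, 1)) := fun k x => by
    simp [c, ← hneg]
  have hcr1 : ∀ k x, c (.inr (k, 1)) x = -θ x (e (k, 0)) := fun k x => by
    simp [c, ← hneg]
  refine ⟨b, fun k => -M (e (k, 0)) (e (k, 1)), ?_, ?_, ?_, ?_, ?_, ?_, ?_⟩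
  · intro x
    rw [hrepr, hrepr, hb1, hc0, ← neg_eq_iff_eq_neg.2 (hθ v x), hneg x v, hv, neg_neg]
  · intro i j
    rw [hrepr, hbr, hbr, hc0, ← he, hθ, neg_neg]
  · intro k l
    rw [hrepr, hb1, hbr, hcr1, ← hM', h0, neg_zero]
  · intro k l hkl
    rw [hrepr, hb1, hbr, hcr0, ← hM', h1 k l hkl]
  · intro k
    rw [hrepr, hb1, hbr, hcr0, ← hM', neg_neg]
  -- Antisymmetrization exchanges the arguments of `M` here, as the two vectors lie in different
  -- pairs; within one pair it adds the constant that turns `a k` into `1 + a k`.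
  · intro k l hkl
    have := hM (e (k, 1)) (e (l, 0))
    rw [h1 l k hkl, he, symplecticGram, if_neg hkl.ne', sub_zero] at this
    rw [hrepr, hb1, hbr, hcr1, ← hM', this, neg_zero]
  · intro k
    have := hM (e (k, 1)) (e (k, 0))
    rw [he, symplecticGram, if_pos rfl, if_neg (by simp), if_neg (by simp)] at this
    rw [hrepr, hb1, hbr, hcr1, ← hM']
    linear_combination -this

/-- Two vectors of one pair have total weight `6 * m + 1`, that of the first basis vector, so the
symplectic pairing survives. The vector of weight `0` acts by a matrix that never raises the weight:
the weights increase along `(0, 0), (1, 0), …` and then along `…, (1, 1), (0, 1)`, the order in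
which `ad v` is triangular. In the limit only its diagonal is left. -/
theorem IsFrobeniusian.exists_contractsOnto {L : Type u} [LieRing L] [LieAlgebra ℂ L] {m : ℕ}
    (h : IsFrobeniusian ℂ L (m + 1)) : ∃ a : Fin m → ℂ, ContractsOnto L (FrobModel a) := by
  obtain ⟨b, a, hω, hGram, h01, h00, h0, h11, h1⟩ := h.exists_triangular_basis
  refine ⟨a, contractsOnto_of_weights b (FrobModel.stdBasis a) (contractionWeight m) ?_⟩
  let P : AdaptedIndex m → AdaptedIndex m → AdaptedIndex m → Prop := fun i j k =>
    (contractionWeight m k < contractionWeight m i + contractionWeight m j ∧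
      maurerCartanForm a k (FrobModel.stdBasis a i) (FrobModel.stdBasis a j) = 0) ∨
    (contractionWeight m k = contractionWeight m i + contractionWeight m j ∧
      b.repr ⁅b i, b j⁆ k =
        -maurerCartanForm a k (FrobModel.stdBasis a i) (FrobModel.stdBasis a j)) ∨
    (b.repr ⁅b i, b j⁆ k = 0 ∧
      maurerCartanForm a k (FrobModel.stdBasis a i) (FrobModel.stdBasis a j) = 0)
  have hsymm : ∀ i j k, P i j k → P j i k := by
    intro i j k hP
    have hL : b.repr ⁅b j, b i⁆ k = -b.repr ⁅b i, b j⁆ k := by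
      rw [← lie_skew, map_neg, Finsupp.neg_apply]
    have hF : maurerCartanForm a k (FrobModel.stdBasis a j) (FrobModel.stdBasis a i) =
        -maurerCartanForm a k (FrobModel.stdBasis a i) (FrobModel.stdBasis a j) := by
      rw [← FrobModel.lieD_coord, ← FrobModel.lieD_coord, lieD, lieD, ← lie_skew, map_neg]
    simpa only [P, hL, hF, neg_eq_zero, neg_inj, add_comm (contractionWeight m j)] using hP
  have hP1 : ∀ j k, P (.inl 1) j k := by
    intro j k
    rcases j with j | ⟨j, s⟩
    · fin_cases j
      · rcases k with k | k
        · fin_cases k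
          · refine Or.inr (Or.inl ⟨by simp [contractionWeight], ?_⟩)
            simp [hω, maurerCartanForm, coordWedge, FrobModel.stdBasis_apply]
          · exact Or.inl ⟨by simp [contractionWeight], by simp [maurerCartanForm]⟩
        · refine Or.inl ⟨?_, ?_⟩
          · have := contractionWeight_inr_mem k
            change contractionWeight m (.inr k) < 0 + (6 * m + 1)
            omega
          · obtain ⟨k, s⟩ := k
            fin_cases s <;> simp [maurerCartanForm, coordWedge, FrobModel.stdBasis_apply]
      · refine Or.inr (Or.inr ⟨by simp, ?_⟩)
        have := FrobModel.lieD_coord a k (FrobModel.stdBasis a (.inl 1))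
          (FrobModel.stdBasis a (.inl 1))
        simpa [lieD] using this.symm
    · rcases k with k | ⟨k, t⟩
      · fin_cases k
        · refine Or.inr (Or.inr ⟨by simp [hω], ?_⟩)
          simp [maurerCartanForm, coordWedge, FrobModel.stdBasis_apply]
        · refine Or.inl ⟨?_, by simp [maurerCartanForm]⟩
          have := contractionWeight_inr_mem (j, s)
          simp only [contractionWeight] at this ⊢
          omega
      -- An entry of `ad v` that raises the weight is zero by triangularity, one that lowers it is
      -- contracted away, and the diagonal ones agree with the model.
      · rcases lt_trichotomy j k with hjk | rfl | hjk
        · fin_cases s <;> fin_cases t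
          · refine Or.inr (Or.inr ⟨h00 j k hjk, ?_⟩)
            simp [maurerCartanForm, coordWedge, FrobModel.stdBasis_apply, hjk.ne']
          · refine Or.inr (Or.inr ⟨h01 j k, ?_⟩)
            simp [maurerCartanForm, coordWedge, FrobModel.stdBasis_apply]
          · refine Or.inl ⟨by simp [contractionWeight]; omega, ?_⟩
            simp [maurerCartanForm, coordWedge, FrobModel.stdBasis_apply]
          · refine Or.inl ⟨by simp [contractionWeight]; omega, ?_⟩
            simp [maurerCartanForm, coordWedge, FrobModel.stdBasis_apply, hjk.ne']
        · fin_cases s <;> fin_cases t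
          · refine Or.inr (Or.inl ⟨by simp [contractionWeight], (h0 j).trans ?_⟩)
            simp [maurerCartanForm, coordWedge, FrobModel.stdBasis_apply]
          · refine Or.inr (Or.inr ⟨h01 j j, ?_⟩)
            simp [maurerCartanForm, coordWedge, FrobModel.stdBasis_apply]
          · refine Or.inl ⟨by simp [contractionWeight]; omega, ?_⟩
            simp [maurerCartanForm, coordWedge, FrobModel.stdBasis_apply]
          · refine Or.inr (Or.inl ⟨by simp [contractionWeight], (h1 j).trans ?_⟩)
            simp [maurerCartanForm, coordWedge, FrobModel.stdBasis_apply, add_comm]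
        · fin_cases s <;> fin_cases t
          · refine Or.inl ⟨by simp [contractionWeight, hjk], ?_⟩
            simp [maurerCartanForm, coordWedge, FrobModel.stdBasis_apply, hjk.ne]
          · refine Or.inr (Or.inr ⟨h01 j k, ?_⟩)
            simp [maurerCartanForm, coordWedge, FrobModel.stdBasis_apply]
          · refine Or.inl ⟨by simp [contractionWeight]; omega, ?_⟩
            simp [maurerCartanForm, coordWedge, FrobModel.stdBasis_apply]
          · refine Or.inr (Or.inr ⟨h11 j k hjk, ?_⟩)
            simp [maurerCartanForm, coordWedge, FrobModel.stdBasis_apply, hjk.ne]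
  -- The first basis vector has the largest weight and the other factor has positive weight, so the
  -- whole bracket is contracted to zero.
  have hP0 : ∀ j k, P (.inl 0) (.inr j) k := by
    intro j k
    have hj := contractionWeight_inr_mem j
    have hk : contractionWeight m k ≤ 6 * m + 1 := by
      rcases k with k | k
      · fin_cases k <;> simp [contractionWeight]
      · have := contractionWeight_inr_mem k
        omega
    refine Or.inl ⟨?_, ?_⟩
    · rw [show contractionWeight m (.inl 0) = 6 * m + 1 from rfl]
      omega
    · rcases k with k | ⟨k, s⟩
      · fin_cases k <;> simp [maurerCartanForm, coordWedge, FrobModel.stdBasis_apply]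
      · fin_cases s <;> simp [maurerCartanForm, coordWedge, FrobModel.stdBasis_apply]
  have hP00 : ∀ k, P (.inl 0) (.inl 0) k := by
    intro k
    refine Or.inr (Or.inr ⟨by simp, ?_⟩)
    have := FrobModel.lieD_coord a k (FrobModel.stdBasis a (.inl 0))
      (FrobModel.stdBasis a (.inl 0))
    simpa [lieD] using this.symm
  have hPr : ∀ i j k, P (.inr i) (.inr j) k := by
    intro i j k
    have hi := contractionWeight_inr_mem i
    have hj := contractionWeight_inr_mem j
    rcases k with k | k
    · fin_cases k
      · have hF := FrobModel.maurerCartanForm_stdBasis_inr a i j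
        by_cases hG : symplecticGram i j = 0
        · exact Or.inr (Or.inr ⟨by simp [hGram, hG], hF.trans hG⟩)
        · refine Or.inr (Or.inl ⟨?_, (hGram i j).trans (congrArg Neg.neg hF.symm)⟩)
          obtain ⟨k, s⟩ := i
          obtain ⟨l, t⟩ := j
          by_cases hkl : k = l
          · subst hkl
            fin_cases s <;> fin_cases t <;> simp [symplecticGram] at hG <;>
              simp [contractionWeight] <;> omega
          · simp [symplecticGram, hkl] at hG
      · refine Or.inl ⟨?_, by simp [maurerCartanForm]⟩
        simp only [contractionWeight] at hi ⊢
        omega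
    · have hk := contractionWeight_inr_mem k
      refine Or.inl ⟨by omega, ?_⟩
      obtain ⟨k, s⟩ := k
      fin_cases s <;> simp [maurerCartanForm, coordWedge, FrobModel.stdBasis_apply]
  suffices hP : ∀ i j k, P i j k by
    intro i j k
    rw [FrobModel.stdBasis_repr, FrobModel.lie_apply, neg_eq_zero]
    exact hP i j k
  rintro (i | i) (j | j) k
  · fin_cases i <;> fin_cases j
    exacts [hP00 k, hsymm _ _ _ (hP1 _ k), hP1 _ k, hP1 _ k]
  · fin_cases i
    exacts [hP0 _ k, hP1 _ k]
  · fin_cases j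
    exacts [hsymm _ _ _ (hP0 _ k), hsymm _ _ _ (hP1 _ k)]
  · exact hPr i j k

theorem mainTheorem1 (p : ℕ) (hp : 1 ≤ p) :
    -- the members of the family are `2p`-dimensional frobeniusian Lie algebras
    (∀ a : Fin (p - 1) → ℂ, IsFrobeniusian ℂ (FrobModel a) p) ∧
    -- every `2p`-dimensional frobeniusian Lie algebra contracts onto a member of the family
    (∀ (L : Type u) [LieRing L] [LieAlgebra ℂ L], IsFrobeniusian ℂ L p →
      ∃ a : Fin (p - 1) → ℂ, ContractsOnto L (FrobModel a)) ∧
    -- a member contracts onto no other member, up to isomorphism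
    (∀ a a' : Fin (p - 1) → ℂ, ContractsOnto (FrobModel a) (FrobModel a') →
      Nonempty (FrobModel a ≃ₗ⁅ℂ⁆ FrobModel a')) ∧
    -- every formal deformation of a member is frobeniusian
    (∀ (a : Fin (p - 1) → ℂ) (G : Type u) [LieRing G] [LieAlgebra (PowerSeries ℂ) G],
      IsFormalDeformation (FrobModel a) G → IsFrobeniusian (PowerSeries ℂ) G p) ∧
    -- in the variety of Lie algebra laws on `ℂ^(2p)`, every member has a (basic) Zariski open
    -- neighbourhood that consists of frobeniusian Lie algebras
    (∀ (a : Fin (p - 1) → ℂ) (b : Module.Basis (Fin (2 * p)) ℂ (FrobModel a)),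
      ∃ P : MvPolynomial (Fin (2 * p) × Fin (2 * p) × Fin (2 * p)) ℂ,
        MvPolynomial.eval (structureConstants b) P ≠ 0 ∧
        ∀ (L : Type u) [LieRing L] [LieAlgebra ℂ L] (b' : Module.Basis (Fin (2 * p)) ℂ L),
          MvPolynomial.eval (structureConstants b') P ≠ 0 → IsFrobeniusian ℂ L p) := by
  obtain ⟨m, rfl⟩ : ∃ m, p = m + 1 := ⟨p - 1, by omega⟩
  exact ⟨fun a => FrobModel.isFrobeniusian a,
    fun L _ _ hL => hL.exists_contractsOnto,
    fun a a' h => FrobModel.nonempty_lieEquiv_of_contractsOnto h,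
    fun a G _ _ hG => hG.isFrobeniusian hp (FrobModel.isFrobeniusian a),
    fun a b => (FrobModel.isFrobeniusian a).exists_polynomial hp b⟩
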